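/- Let $X$ be a complex Banach space whose elements are functions $x:\Omega\to\mathbb C$ on a set $\Omega$, with pointwise linear operations. Call $x\in X$ positive if $x(\omega)\in[0,\infty)$ for all $\omega\in\Omega$. Assume that for every $x\in X$ the functions $\overline{x}$ (pointwise conjugate) and $|x|$ (pointwise absolute value) belong to $X$ and $\|\overline x\|=\||x|\|=\|x\|$, and that $\|x\|\le\|y\|$ whenever $x,y\in X$ and $0\le x(\omega)\le y(\omega)$ for all $\omega\in\Omega$. Let $Q\ne0$ be a bounded linear operator on $X$ that is quasinilpotent, i.e. $\sigma(Q)=\{0\}$, and suppose that for some $\zeta\in\mathbb C$, $\zeta\neq0$, the operator $\zeta Q$ maps positive elements of $X$ to positive elements of $X$. Define $$\mathcal A_Q=\Big\{z\in\mathbb C:\limsup_{s\to+\infty}\|(I-szQ)^{-1}\|<\infty\Big\},\qquad \mathcal B_Q=\Big\{z\in\mathbb C:\sup_{j\ge1}\|(I+zQ)^j\|<\infty\Big\},$$ $$\mathcal G_Q=\Big\{z\in\mathbb C:\limsup_{t\to+\infty}\|e^{tzQ}\|<\infty\Big\},\qquad \mathcal T_Q^{\alpha}=\Big\{z\in\mathbb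 C:\limsup_{j\to\infty}\,(j+1)^{\alpha}\|zQ(I+zQ)^j\|<\infty\Big\}\quad(\alpha>0),$$ and $\mathcal T_Q=\mathcal T_Q^{1}$; let $\mathcal B_Q^\circ$ be the interior of $\mathcal B_Q$ in $\mathbb C$. If $\mathcal G_Q\ne\{0\}$, then $$\mathcal T_Q=\mathcal B_Q^\circ\cup\{0\}\subset\mathcal B_Q\qquad\text{and}\qquad \mathcal T_Q^{1/2}\subset\mathcal A_Q .$$ In particular, with $T(z)=I+zQ$, for every $z\in\mathbb C$ the Tauberian condition $\sup_{j\ge1}(j+1)\|(I-T(z))T(z)^j\|<\infty$ implies that $T(z)=I+zQ$ is power-bounded. -/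

import Mathlib

open Filter Topology
open scoped ENNReal ComplexOrder ComplexConjugate

noncomputable section

namespace Microspectral

variable {X : Type*} [NormedAddCommGroup X] [NormedSpace ℂ X]

/-- A bounded operator is quasinilpotent if its spectrum is `{0}`. -/
def IsQuasinilpotent (Q : X →L[ℂ] X) : Prop :=
  spectrum ℂ Q = {0}

/-- The Abel set of order `k`: the `z` with `limsup ‖(1 - s z Q)⁻ᵏ‖ < ∞` as `s → +∞`. -/
def abelSet (Q : X →L[ℂ] X) (k : ℕ) : Set ℂ :=
  {z | limsup (fun s : ℝ ↦
    ENNReal.ofReal ‖(Ring.inverse (1 - ((s : ℂ) * z) • Q)) ^ k‖) atTop < ∞}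

/-- The power-bounded set: the `z` for which `1 + z Q` is power-bounded. -/
def powerBoundedSet (Q : X →L[ℂ] X) : Set ℂ :=
  {z | ∃ N : ℝ, ∀ j : ℕ, 1 ≤ j → ‖(1 + z • Q) ^ j‖ ≤ N}

/-- The `z` with `limsup ‖exp (t z Q)‖ < ∞` as `t → +∞`. -/
def semigroupSet (Q : X →L[ℂ] X) : Set ℂ :=
  {z | limsup (fun t : ℝ ↦
    ENNReal.ofReal ‖NormedSpace.exp (((t : ℂ) * z) • Q)‖) atTop < ∞}

/-- The Tauberian set of exponent `α`: the `z` with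
`limsup (j + 1) ^ α ‖z Q (1 + z Q) ^ j‖ < ∞` as `j → ∞`. -/
def tauberianSet (Q : X →L[ℂ] X) (α : ℝ) : Set ℂ :=
  {z | limsup (fun j : ℕ ↦
    ENNReal.ofReal (((j : ℝ) + 1) ^ α * ‖(z • Q) * (1 + z • Q) ^ j‖)) atTop < ∞}

/-- The normed space `X` is an ordered complex function space on the set of points `Ω`: via the
injective linear evaluation map `ev`, its elements are functions `Ω → ℂ`; it contains the conjugate
and the absolute value of each of its elements, with the same norm; and the norm is monotone on
positive elements. The order on `ℂ` is the one where `z ≤ w` means that `w - z` is real and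
nonnegative. -/
structure IsOrderedComplexFunctionSpace {Ω : Type*} (ev : X →ₗ[ℂ] (Ω → ℂ)) : Prop where
  injective : Function.Injective ev
  exists_conj : ∀ x : X, ∃ y : X, (∀ ω, ev y ω = conj (ev x ω)) ∧ ‖y‖ = ‖x‖
  exists_abs : ∀ x : X, ∃ y : X, (∀ ω, ev y ω = ((‖ev x ω‖ : ℝ) : ℂ)) ∧ ‖y‖ = ‖x‖
  norm_mono : ∀ x y : X, (∀ ω, 0 ≤ ev x ω ∧ ev x ω ≤ ev y ω) → ‖x‖ ≤ ‖y‖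

/-- An operator is positive real if it maps positive real vectors, i.e. those with values in
`[0, ∞)`, to positive real vectors. -/
def IsPositiveReal {Ω : Type*} (ev : X →ₗ[ℂ] (Ω → ℂ)) (T : X →L[ℂ] X) : Prop :=
  ∀ x : X, (∀ ω, 0 ≤ ev x ω) → ∀ ω, 0 ≤ ev (T x) ω

end Microspectral

end

/-! ### Decay and boundedness of one-parameter exponentials in a Banach algebra. -/

namespace Microspectral

section BanachAlgebra

variable {𝔸 : Type*} [NormedRing 𝔸] [NormedAlgebra ℂ 𝔸]

/-! Scale so that `P = ζ • Q` is positive, and write `z = w * ζ`. Two facts come from positivity.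
Conjugation is an isometry commuting with `P`, so estimates for `exp (t w P)` and `P exp (t w P)`
hold for the conjugate of `w` too, and multiplying the two gives estimates for exponentials of `2 t
(Re w) P`. Moreover every term of the exponential series of a positive operator is dominated in norm
by the sum (`norm_term_le_norm_exp`).

A bounded `exp (t w P)` therefore excludes `Re w > 0`. It excludes `Re w = 0` as well, since a
quasinilpotent generator of a bounded group is zero by Phragmén–Lindelöf and Liouville. So `exp (-t
P)` is bounded (`exists_norm_exp_neg_le`). A nonzero `w` satisfying the Tauberian condition of
exponent `1/2` has `P exp (t w P) → 0` by Poisson averaging, which forces `Re w < 0`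
(`re_neg_of_tendsto`); the Abel bound is then a Laplace transform estimate.

For exponent `1`, averaging gives `P exp (t w P) = O(1/t)`, hence `P² exp (-t P) = O(1/t²)`, and a
Landau inequality yields `P exp (-t P) = O(1/t)`. Moving along the segment from `-1` to `w` shows
that `exp (t w P)` is bounded (`exists_norm_exp_le`), and comparison with `(1 + w P) ^ n` gives
power-boundedness (`exists_norm_one_add_pow_le`). The Ritt estimate makes this stable under
perturbation, so `w` is interior. Conversely, Cauchy's estimate gives the Ritt bound at interior
points. -/

theorem commute_exp_smul (a : ℂ) (A : 𝔸) : Commute A (NormedSpace.exp (a • A)) :=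
  ((Commute.refl A).smul_right a).exp_right

variable [CompleteSpace 𝔸]

theorem exp_add_smul (a b : ℂ) (A : 𝔸) :
    NormedSpace.exp ((a + b) • A) = NormedSpace.exp (a • A) * NormedSpace.exp (b • A) := by
  let +nondep : NormedAlgebra ℚ 𝔸 := .restrictScalars ℚ ℂ 𝔸
  rw [add_smul]
  exact NormedSpace.exp_add_of_commute (((Commute.refl A).smul_left a).smul_right b)

theorem norm_exp_add_smul_le (a b : ℂ) (P : 𝔸) : ‖NormedSpace.exp ((a + b) • P)‖ ≤
    ‖NormedSpace.exp (a • P)‖ * ‖NormedSpace.exp (b • P)‖ := by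
  rw [exp_add_smul]
  exact norm_mul_le _ _

/-- One factor `P` goes to each exponential. With `b` the conjugate of `a`, this transfers decay to
a real exponent. -/
theorem norm_sq_mul_exp_add_smul_le (a b : ℂ) (P : 𝔸) :
    ‖P * P * NormedSpace.exp ((a + b) • P)‖ ≤
      ‖P * NormedSpace.exp (a • P)‖ * ‖P * NormedSpace.exp (b • P)‖ := by
  have : P * P * NormedSpace.exp ((a + b) • P) =
      P * NormedSpace.exp (a • P) * (P * NormedSpace.exp (b • P)) := by
    rw [exp_add_smul, mul_assoc, ← mul_assoc P (NormedSpace.exp (a • P)),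
      (commute_exp_smul a P).eq]
    simp only [mul_assoc]
    rw [← mul_assoc P (NormedSpace.exp (a • P)), (commute_exp_smul a P).eq, mul_assoc]
  rw [this]
  exact norm_mul_le _ _

theorem exp_smul_one_add (c : ℂ) (A : 𝔸) :
    NormedSpace.exp (c • (1 : 𝔸) + A) = Complex.exp c • NormedSpace.exp A := by
  let +nondep : NormedAlgebra ℚ 𝔸 := .restrictScalars ℚ ℂ 𝔸
  rw [NormedSpace.exp_add_of_commute ((Commute.one_left A).smul_left c),
    ← Algebra.algebraMap_eq_smul_one, ← NormedSpace.algebraMap_exp_comm,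
    ← Complex.exp_eq_exp_ℂ, ← Algebra.smul_def]

theorem continuous_exp_smul (A : 𝔸) : Continuous fun c : ℂ ↦ NormedSpace.exp (c • A) :=
  continuous_iff_continuousAt.2 fun c ↦ (hasDerivAt_exp_smul_const (𝕂 := ℂ) A c).continuousAt

theorem hasDerivAt_exp_line (A : 𝔸) (a b : ℂ) (s : ℝ) :
    HasDerivAt (fun s : ℝ ↦ NormedSpace.exp ((a + s * b) • A))
      (b • (A * NormedSpace.exp ((a + s * b) • A))) s :=
  HasDerivAt.scomp (h := fun s : ℝ ↦ a + s * b) s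
    (hasDerivAt_exp_smul_const' (𝕂 := ℂ) A (a + s * b))
    (by simpa using ((Complex.ofRealCLM.hasDerivAt (x := s)).mul_const b).const_add a)

/-- `exp (t A) = e⁻ᵗ ∑ tⁿ (1 + A)ⁿ / n!`. -/
theorem norm_mul_exp_le_of_hasSum {A : 𝔸} {c : ℕ → ℝ} (hc : ∀ n, ‖A * (1 + A) ^ n‖ ≤ c n)
    {t : ℝ} (ht : 0 ≤ t) {S : ℝ} (hS : HasSum (fun n : ℕ ↦ t ^ n / n.factorial * c n) S) :
    ‖A * NormedSpace.exp ((t : ℂ) • A)‖ ≤ Real.exp (-t) * S := by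
  have h1 : NormedSpace.exp ((t : ℂ) • (1 + A)) =
      Complex.exp t • NormedSpace.exp ((t : ℂ) • A) := by
    rw [smul_add, exp_smul_one_add]
  have h2 : HasSum (fun n : ℕ ↦ A * (((n.factorial : ℂ)⁻¹) • ((t : ℂ) • (1 + A)) ^ n))
      (A * (Complex.exp t • NormedSpace.exp ((t : ℂ) • A))) := by
    rw [← h1]
    exact (NormedSpace.exp_series_hasSum_exp' (𝕂 := ℂ) _).mul_left A
  have h3 : ‖A * (Complex.exp t • NormedSpace.exp ((t : ℂ) • A))‖ ≤ S := by
    refine h2.norm_le_of_bounded hS fun n ↦ ?_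
    rw [smul_pow, mul_smul_comm, mul_smul_comm, norm_smul, norm_smul, norm_inv, norm_pow,
      Complex.norm_natCast, Complex.norm_real, Real.norm_of_nonneg ht, ← mul_assoc,
      inv_mul_eq_div]
    gcongr
    exact hc n
  rw [mul_smul_comm, norm_smul, Complex.norm_exp, Complex.ofReal_re] at h3
  rw [Real.exp_neg, inv_mul_eq_div, le_div_iff₀ (Real.exp_pos t)]
  linarith

theorem hasSum_pow_div_factorial (t : ℝ) :
    HasSum (fun n : ℕ ↦ t ^ n / n.factorial) (Real.exp t) := by
  rw [Real.exp_eq_exp_ℝ]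
  exact NormedSpace.expSeries_div_hasSum_exp t

theorem hasSum_pow_div_factorial_div {t : ℝ} (ht : 0 < t) :
    HasSum (fun n : ℕ ↦ t ^ n / n.factorial * (1 / ((n : ℝ) + 1))) ((Real.exp t - 1) / t) := by
  have h := (hasSum_nat_add_iff' (f := fun n : ℕ ↦ t ^ n / n.factorial) 1).2
    (hasSum_pow_div_factorial t)
  simp only [Finset.range_one, Finset.sum_singleton, pow_zero, Nat.factorial_zero,
    Nat.cast_one, div_one] at h
  refine (h.div_const t).congr_fun fun n ↦ ?_
  rw [Nat.factorial_succ]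
  push_cast
  have : (n.factorial : ℝ) ≠ 0 := by positivity
  field_simp
  ring

/-- The Poisson mean of `1 / (n + 1)` with parameter `t` is `(1 - exp (-t)) / t`. -/
theorem norm_mul_exp_le_div {A : 𝔸} {C : ℝ} (hC : ∀ n : ℕ, ((n : ℝ) + 1) * ‖A * (1 + A) ^ n‖ ≤ C)
    {t : ℝ} (ht : 0 < t) : ‖A * NormedSpace.exp ((t : ℂ) • A)‖ ≤ C / t := by
  have hC0 : 0 ≤ C := le_trans (by positivity) (hC 0)
  have h := norm_mul_exp_le_of_hasSum (A := A) (c := fun n ↦ 1 / ((n : ℝ) + 1) * C)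
    (fun n ↦ by rw [one_div_mul_eq_div, le_div_iff₀ (by positivity), mul_comm]; exact hC n) ht.le
    (S := (Real.exp t - 1) / t * C)
    (by simpa only [mul_assoc] using (hasSum_pow_div_factorial_div ht).mul_right C)
  refine h.trans ?_
  have : Real.exp (-t) * ((Real.exp t - 1) / t * C) = C / t * (1 - Real.exp (-t)) := by
    rw [Real.exp_neg]; field_simp
  rw [this]
  exact mul_le_of_le_one_right (by positivity) (by linarith [Real.exp_pos (-t)])

/-- By AM-GM, `1 / √(n + 1) ≤ (√t / (n + 1) + 1 / √t) / 2`, and the Poisson mean of the right side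
is explicit. -/
theorem norm_mul_exp_le_div_sqrt {A : 𝔸} {C : ℝ}
    (hC : ∀ n : ℕ, √((n : ℝ) + 1) * ‖A * (1 + A) ^ n‖ ≤ C)
    {t : ℝ} (ht : 0 < t) : ‖A * NormedSpace.exp ((t : ℂ) • A)‖ ≤ C / √t := by
  have hC0 : 0 ≤ C := le_trans (by positivity) (hC 0)
  have hst : 0 < √t := Real.sqrt_pos.2 ht
  have hs := ((hasSum_pow_div_factorial_div ht).mul_right (√t * (C / 2))).add
    ((hasSum_pow_div_factorial t).mul_right (1 / √t * (C / 2)))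
  have h := norm_mul_exp_le_of_hasSum (A := A)
    (c := fun n ↦ 1 / ((n : ℝ) + 1) * (√t * (C / 2)) + 1 / √t * (C / 2)) (fun n ↦ ?_) ht.le
    (S := (Real.exp t - 1) / t * (√t * (C / 2)) + Real.exp t * (1 / √t * (C / 2)))
    (by simpa only [mul_add, mul_assoc] using hs)
  · refine h.trans ?_
    have : Real.exp (-t) * ((Real.exp t - 1) / t * (√t * (C / 2)) +
        Real.exp t * (1 / √t * (C / 2))) = C / √t * (1 - Real.exp (-t) / 2) := by
      rw [Real.exp_neg]
      field_simp
      rw [Real.sq_sqrt ht.le]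
      ring
    rw [this]
    exact mul_le_of_le_one_right (by positivity) (by linarith [Real.exp_pos (-t)])
  · have hn : 0 < √((n : ℝ) + 1) := Real.sqrt_pos.2 (by positivity)
    have h1 : ‖A * (1 + A) ^ n‖ ≤ C / √((n : ℝ) + 1) := by
      rw [le_div_iff₀ hn, mul_comm]; exact hC n
    refine h1.trans ?_
    have h2 : (n : ℝ) + 1 = √((n : ℝ) + 1) ^ 2 := (Real.sq_sqrt (by positivity)).symm
    rw [h2, Real.sqrt_sq hn.le]
    generalize √((n : ℝ) + 1) = a at *
    generalize √t = b at *
    have : 1 / a ^ 2 * (b * (C / 2)) + 1 / b * (C / 2) - C / a = C / 2 * ((a - b) ^ 2 / (a ^ 2 * b)) := by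
      field_simp; ring
    have : 0 ≤ C / 2 * ((a - b) ^ 2 / (a ^ 2 * b)) := by positivity
    linarith

/-- A Landau inequality for a bounded semigroup. -/
theorem norm_mul_exp_le_of_sq {P : 𝔸} {M K : ℝ}
    (hM : ∀ t : ℝ, 0 ≤ t → ‖NormedSpace.exp ((t : ℂ) • P)‖ ≤ M)
    (hK : ∀ t : ℝ, 0 < t → ‖P * P * NormedSpace.exp ((t : ℂ) • P)‖ ≤ K / t ^ 2)
    {t : ℝ} (ht : 0 < t) : ‖P * NormedSpace.exp ((t : ℂ) • P)‖ ≤ (2 * M + K) / t := by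
  have hK0 : 0 ≤ K := by simpa using (norm_nonneg _).trans (hK 1 one_pos)
  set f : ℝ → 𝔸 := fun s ↦ NormedSpace.exp ((s : ℂ) • P) with hf
  have hd (s : ℝ) : HasDerivAt f (P * f s) s := by
    simpa [hf] using hasDerivAt_exp_line P 0 1 s
  have hd2 (s : ℝ) : HasDerivAt (fun s ↦ P * f s) (P * (P * f s)) s := (hd s).const_mul P
  have h1 (s : ℝ) (hs : s ∈ Set.Icc t (2 * t)) : ‖P * f s - P * f t‖ ≤ K / t := by
    have := Convex.norm_image_sub_le_of_norm_hasDerivWithin_le (𝕜 := ℝ) (C := K / t ^ 2)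
      (fun x _ ↦ (hd2 x).hasDerivWithinAt) (fun x hx ↦ ?_) (convex_Icc t (2 * t))
      (Set.left_mem_Icc.2 (by linarith)) hs
    · refine this.trans ?_
      rw [Real.norm_of_nonneg (by linarith [hs.1])]
      calc K / t ^ 2 * (s - t) ≤ K / t ^ 2 * t := by gcongr; linarith [hs.2]
        _ = K / t := by field_simp
    · rw [← mul_assoc]
      exact (hK x (ht.trans_le hx.1)).trans (by gcongr; exact hx.1)
  -- First-order Taylor on `[t, 2t]`: `f (2t) - f t` differs from `t P f(t)` by at most `K`.
  have h2 := Convex.norm_image_sub_le_of_norm_hasDerivWithin_le (𝕜 := ℝ) (C := K / t)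
      (f := fun s ↦ f s - s • (P * f t)) (f' := fun s ↦ P * f s - (1 : ℝ) • (P * f t))
      (fun x _ ↦ ((hd x).sub ((hasDerivAt_id x).smul_const (P * f t))).hasDerivWithinAt)
      (fun x hx ↦ by rw [one_smul]; exact h1 x hx) (convex_Icc t (2 * t))
      (Set.left_mem_Icc.2 (by linarith)) (Set.right_mem_Icc.2 (by linarith))
  have h3 : t • (P * f t) = f (2 * t) - f t -
      ((f (2 * t) - (2 * t) • (P * f t)) - (f t - t • (P * f t))) := by
    rw [two_mul, add_smul]; abel
  have h4 : ‖t • (P * f t)‖ ≤ M + M + K := by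
    rw [h3]
    refine (norm_sub_le _ _).trans (add_le_add ((norm_sub_le _ _).trans
      (add_le_add (hM _ (by linarith)) (hM _ ht.le))) (h2.trans_eq ?_))
    rw [two_mul, add_sub_cancel_right, Real.norm_of_nonneg ht.le]
    field_simp
  rw [norm_smul, Real.norm_of_nonneg ht.le] at h4
  rw [le_div_iff₀ ht]
  linarith

/-- A bound along the segment from `-1` to `w` carries the boundedness of `exp (-t P)` over to
`exp (t w P)`. -/
theorem exists_norm_exp_le {P : 𝔸} {w : ℂ} {M K C : ℝ}
    (hM : ∀ t : ℝ, 0 ≤ t → ‖NormedSpace.exp ((t : ℂ) • (-P))‖ ≤ M)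
    (hK : ∀ t : ℝ, 0 < t → ‖P * NormedSpace.exp ((t : ℂ) • (-P))‖ ≤ K / t)
    (hC : ∀ t : ℝ, 0 < t → ‖P * NormedSpace.exp ((t : ℂ) • (w • P))‖ ≤ C / t) :
    ∃ N : ℝ, ∀ t : ℝ, 0 ≤ t → ‖NormedSpace.exp ((t : ℂ) • (w • P))‖ ≤ N := by
  have hK0 : 0 ≤ K := by simpa using (norm_nonneg _).trans (hK 1 one_pos)
  have hC0 : 0 ≤ C := by simpa using (norm_nonneg _).trans (hC 1 one_pos)
  have hM0 : 0 ≤ M := (norm_nonneg _).trans (hM 0 le_rfl)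
  set L : ℝ := ‖1 + w‖
  have hL0 : 0 ≤ L := norm_nonneg _
  -- `r` cuts the segment: the bound by `C` is singular at the end `-1`, so the bound by `K` is used
  -- for `s ≤ r`. There the increment is at most half the maximum of `g` and can be absorbed.
  set r : ℝ := 1 / (4 * (L * K + 1)) with hr
  have hr0 : 0 < r := by positivity
  have hr1 : r ≤ 1 / 2 := by
    rw [hr]; gcongr; nlinarith [mul_nonneg hL0 hK0]
  have hrL : 2 * (L * K) * r ≤ 1 / 2 := by
    rw [hr, mul_one_div, div_le_iff₀ (by positivity)]; linarith
  refine ⟨‖(1 : 𝔸)‖ + 2 * (M + L * C * M / r), fun T hT ↦ ?_⟩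
  set g : ℝ → ℝ := fun t ↦ ‖NormedSpace.exp ((t : ℂ) • (w • P))‖ with hg
  have hgc : Continuous g :=
    ((continuous_exp_smul (w • P)).comp Complex.continuous_ofReal).norm
  obtain ⟨τ, hτ, hmax⟩ := (isCompact_Icc (a := (0 : ℝ)) (b := T)).exists_isMaxOn
    ⟨0, Set.left_mem_Icc.2 hT⟩ hgc.continuousOn
  have hmax' (s : ℝ) (h0 : 0 ≤ s) (h1 : s ≤ T) : g s ≤ g τ := hmax (Set.mem_Icc.2 ⟨h0, h1⟩)
  suffices g τ ≤ ‖(1 : 𝔸)‖ + 2 * (M + L * C * M / r) from (hmax' T hT le_rfl).trans this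
  rcases hτ.1.eq_or_lt with h0 | h0
  · rw [← h0, hg]
    simp only [Complex.ofReal_zero, zero_smul, NormedSpace.exp_zero]
    have : 0 ≤ 2 * (M + L * C * M / r) := by positivity
    linarith
  -- The path joins `exp (-τ P)` to `exp (τ w P)`. Since `τ` maximizes `g` on `[0, T]`, the factor
  -- `g (s τ)` is at most `g τ`.
  set h : ℝ → 𝔸 := fun s ↦ NormedSpace.exp ((-(τ : ℂ) + s * (τ * (1 + w))) • P) with hh
  have hd (s : ℝ) := hasDerivAt_exp_line P (-(τ : ℂ)) (τ * (1 + w)) s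
  have hsplit (s : ℝ) : h s = NormedSpace.exp ((((1 - s) * τ : ℝ) : ℂ) • (-P)) *
      NormedSpace.exp (((s * τ : ℝ) : ℂ) • (w • P)) := by
    rw [smul_neg, ← neg_smul, smul_smul, ← exp_add_smul, hh]
    simp only
    congr 2
    push_cast
    ring
  have hnorm (s : ℝ) : ‖((τ : ℂ) * (1 + w)) • (P * h s)‖ = τ * L * ‖P * h s‖ := by
    rw [norm_smul, norm_mul, Complex.norm_real, Real.norm_of_nonneg h0.le]
  have e0 : ‖h 0‖ ≤ M := by
    have := hM τ h0.le
    rw [hsplit]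
    simpa using this
  have e1 : ‖h 1‖ = g τ := by
    rw [hsplit]
    simp [hg]
  have d1 := Convex.norm_image_sub_le_of_norm_hasDerivWithin_le (𝕜 := ℝ)
    (C := 2 * (L * K) * g τ) (fun s _ ↦ (hd s).hasDerivWithinAt) (fun s hs ↦ ?_)
    (convex_Icc (0 : ℝ) r) (Set.left_mem_Icc.2 hr0.le) (Set.right_mem_Icc.2 hr0.le)
  have d2 := Convex.norm_image_sub_le_of_norm_hasDerivWithin_le (𝕜 := ℝ)
    (C := L * C * M / r) (fun s _ ↦ (hd s).hasDerivWithinAt) (fun s hs ↦ ?_)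
    (convex_Icc r 1) (Set.left_mem_Icc.2 (by linarith)) (Set.right_mem_Icc.2 (by linarith))
  · change ‖h r - h 0‖ ≤ _ at d1
    change ‖h 1 - h r‖ ≤ _ at d2
    have t1 : ‖h 1‖ ≤ ‖h 1 - h r‖ + ‖h r - h 0‖ + ‖h 0‖ :=
      calc ‖h 1‖ = ‖(h 1 - h r) + (h r - h 0) + h 0‖ := by congr 1; abel
        _ ≤ _ := norm_add₃_le
    rw [Real.norm_of_nonneg (by linarith)] at d2
    rw [sub_zero, Real.norm_of_nonneg hr0.le] at d1
    have d3 : 2 * (L * K) * g τ * r ≤ 1 / 2 * g τ := by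
      have := mul_le_mul_of_nonneg_right hrL (norm_nonneg _ : 0 ≤ g τ)
      linarith
    have d4 : L * C * M / r * (1 - r) ≤ L * C * M / r :=
      mul_le_of_le_one_right (by positivity) (by linarith)
    have := norm_nonneg (1 : 𝔸)
    linarith
  · change ‖((τ : ℂ) * (1 + w)) • (P * h s)‖ ≤ _
    have hs0 : 0 < s := hr0.trans_le hs.1
    have hcomm : Commute P (NormedSpace.exp ((((1 - s) * τ : ℝ) : ℂ) • (-P))) := by
      rw [smul_neg, ← neg_smul]
      exact commute_exp_smul _ P
    rw [hnorm, hsplit, ← mul_assoc, hcomm.eq, mul_assoc _ P]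
    calc τ * L * ‖NormedSpace.exp ((((1 - s) * τ : ℝ) : ℂ) • (-P)) *
          (P * NormedSpace.exp (((s * τ : ℝ) : ℂ) • (w • P)))‖
        ≤ τ * L * (M * (C / (s * τ))) := by
          gcongr
          refine (norm_mul_le _ _).trans (mul_le_mul
            (hM _ (mul_nonneg (by linarith [hs.2]) h0.le)) (hC _ (by positivity))
            (norm_nonneg _) hM0)
      _ = L * C * M / s := by field_simp
      _ ≤ L * C * M / r := by gcongr; exact hs.1
  · change ‖((τ : ℂ) * (1 + w)) • (P * h s)‖ ≤ _
    have hs1 : 1 / 2 ≤ 1 - s := by linarith [hs.2]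
    have hst : s * τ ≤ T := by nlinarith [hs.1, hs.2, hτ.2]
    rw [hnorm, hsplit, ← mul_assoc]
    calc τ * L * ‖P * NormedSpace.exp ((((1 - s) * τ : ℝ) : ℂ) • (-P)) *
          NormedSpace.exp (((s * τ : ℝ) : ℂ) • (w • P))‖
        ≤ τ * L * (K / ((1 - s) * τ) * g τ) := by
          gcongr
          refine (norm_mul_le _ _).trans (mul_le_mul (hK _ (by positivity))
            (hmax' _ (mul_nonneg hs.1 h0.le) hst) (norm_nonneg _) (by positivity))
      _ = L * K * g τ / (1 - s) := by field_simp
      _ ≤ L * K * g τ / (1 / 2) := by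
          have : 0 ≤ g τ := norm_nonneg _
          gcongr
      _ = 2 * (L * K) * g τ := by ring

end BanachAlgebra
end Microspectral

/-! ### Powers of `1 + z Q`, resolvent bounds, and quasinilpotent generators. -/

namespace Microspectral

section BanachAlgebra

variable {𝔸 : Type*} [NormedRing 𝔸] [NormedAlgebra ℂ 𝔸]

/-- Binomial expansion with weights summing to `1`. It turns power bounds at finitely many points
into one bound on their convex hull, as Cauchy's estimate needs uniformity. -/
theorem norm_pow_add_smul_le {S T : 𝔸} (hST : Commute S T) {M N : ℝ}
    (hS : ∀ n : ℕ, ‖S ^ n‖ ≤ M) (hT : ∀ n : ℕ, ‖T ^ n‖ ≤ N) {a b : ℝ} (ha : 0 ≤ a) (hb : 0 ≤ b)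
    (hab : a + b = 1) (n : ℕ) : ‖((a : ℂ) • S + (b : ℂ) • T) ^ n‖ ≤ M * N := by
  have hM : 0 ≤ M := (norm_nonneg _).trans (hS 0)
  rw [((hST.smul_left (a : ℂ)).smul_right (b : ℂ)).add_pow]
  have : M * N = ∑ m ∈ Finset.range (n + 1), a ^ m * b ^ (n - m) * (n.choose m) * (M * N) := by
    rw [← Finset.sum_mul, ← add_pow, hab, one_pow, one_mul]
  rw [this]
  refine norm_sum_le_of_le _ fun m _ ↦ ?_
  rw [smul_pow, smul_pow, smul_mul_smul_comm, ← nsmul_eq_mul', ← Nat.cast_smul_eq_nsmul ℂ,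
    norm_smul, norm_smul, norm_mul, norm_pow, norm_pow, Complex.norm_natCast, Complex.norm_real,
    Complex.norm_real, Real.norm_of_nonneg ha, Real.norm_of_nonneg hb, ← mul_assoc, mul_comm (_ : ℝ) (a ^ m * b ^ (n - m))]
  gcongr
  exact (norm_mul_le _ _).trans (mul_le_mul (hS _) (hT _) (norm_nonneg _) hM)

theorem commute_one_add_smul (Q : 𝔸) (z w : ℂ) : Commute (1 + z • Q) (1 + w • Q) :=
  (Commute.one_left _).add_left
    ((Commute.one_right _).add_right (((Commute.refl Q).smul_left z).smul_right w))

/-- Power-boundedness near `z` gives a Ritt estimate at `z`, by Cauchy's estimate for the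
polynomials `w ↦ (1 + w Q) ^ n`. -/
theorem exists_ritt_of_mem_interior {Q : 𝔸} {z : ℂ}
    (hz : z ∈ interior {w : ℂ | ∃ N : ℝ, ∀ j : ℕ, ‖(1 + w • Q) ^ j‖ ≤ N}) :
    ∃ C : ℝ, ∀ j : ℕ, ((j : ℝ) + 1) * ‖Q * (1 + z • Q) ^ j‖ ≤ C := by
  obtain ⟨ε, hε, hball⟩ := Metric.isOpen_iff.1 isOpen_interior z hz
  set ρ := ε / 2 with hρ
  have hρ0 : 0 < ρ := by positivity
  have key (u : ℂ) (hu : ‖u‖ ≤ ρ) : ∃ N : ℝ, ∀ j : ℕ, ‖(1 + (z + u) • Q) ^ j‖ ≤ N := by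
    refine interior_subset (s := {w : ℂ | ∃ N : ℝ, ∀ j : ℕ, ‖(1 + w • Q) ^ j‖ ≤ N})
      (hball (Metric.mem_ball.2 ?_))
    rw [dist_eq_norm, add_sub_cancel_left]
    linarith
  -- bounds on a segment centred at `z`
  have seg (u : ℂ) (hu : ‖u‖ ≤ ρ) : ∃ N : ℝ, ∀ x : ℝ, |x| ≤ 1 → ∀ j : ℕ,
      ‖(1 + (z + x * u) • Q) ^ j‖ ≤ N := by
    obtain ⟨N₁, h₁⟩ := key u hu
    obtain ⟨N₂, h₂⟩ := key (-u) (by rwa [norm_neg])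
    refine ⟨N₁ * N₂, fun x hx j ↦ ?_⟩
    rw [abs_le] at hx
    have := norm_pow_add_smul_le (commute_one_add_smul Q (z + u) (z + -u)) h₁ h₂
      (a := (1 + x) / 2) (b := (1 - x) / 2) (by linarith) (by linarith) (by ring) j
    convert this using 3
    match_scalars <;> ring
  obtain ⟨N₁, h₁⟩ := seg ρ (by rw [Complex.norm_real, Real.norm_of_nonneg hρ0.le])
  obtain ⟨N₂, h₂⟩ := seg (ρ * Complex.I) (by
    rw [norm_mul, Complex.norm_I, mul_one, Complex.norm_real, Real.norm_of_nonneg hρ0.le])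
  -- Each point of the circle is the midpoint of a point on the horizontal segment and one on the
  -- vertical segment.
  have hbd (w : ℂ) (hw : w ∈ Metric.sphere z (ρ / 2)) (j : ℕ) :
      ‖(1 + w • Q) ^ j‖ ≤ N₁ * N₂ := by
    rw [mem_sphere_iff_norm] at hw
    have hx : |2 * (w - z).re / ρ| ≤ 1 := by
      rw [abs_div, abs_mul, abs_two, abs_of_pos hρ0, div_le_one hρ0]
      linarith [Complex.abs_re_le_norm (w - z)]
    have hy : |2 * (w - z).im / ρ| ≤ 1 := by
      rw [abs_div, abs_mul, abs_two, abs_of_pos hρ0, div_le_one hρ0]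
      linarith [Complex.abs_im_le_norm (w - z)]
    have := norm_pow_add_smul_le (commute_one_add_smul Q _ _) (h₁ _ hx) (h₂ _ hy)
      (a := 1 / 2) (b := 1 / 2) (by norm_num) (by norm_num) (by norm_num) j
    convert this using 3
    have hρc : (ρ : ℂ) ≠ 0 := by exact_mod_cast hρ0.ne'
    match_scalars
    · ring
    · have := Complex.re_add_im (w - z)
      field_simp
      linear_combination -2 * this
  refine ⟨N₁ * N₂ / (ρ / 2), fun j ↦ ?_⟩
  have hd (w : ℂ) : HasDerivAt (fun w : ℂ ↦ (1 + w • Q) ^ (j + 1))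
      (((j : ℂ) + 1) • (Q * (1 + w • Q) ^ j)) w := by
    have h0 : HasDerivAt (fun w : ℂ ↦ 1 + w • Q) Q w := by
      simpa using ((hasDerivAt_id w).smul_const Q).const_add (1 : 𝔸)
    have hc : Commute Q (1 + w • Q) := (Commute.one_right Q).add_right ((Commute.refl Q).smul_right w)
    convert h0.fun_pow' (j + 1) using 1
    rw [Finset.sum_congr rfl (g := fun _ ↦ Q * (1 + w • Q) ^ j) fun i hi ↦ ?_]
    · rw [Finset.sum_const, Finset.card_range, ← Nat.cast_smul_eq_nsmul ℂ]
      push_cast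
      rfl
    · rw [← (hc.pow_right _).eq, mul_assoc, ← pow_add, Nat.pred_succ,
        Nat.sub_add_cancel (Nat.lt_succ_iff.1 (Finset.mem_range.1 hi))]
  have := Complex.norm_deriv_le_of_forall_mem_sphere_norm_le (c := z) (half_pos hρ0)
    (f := fun w : ℂ ↦ (1 + w • Q) ^ (j + 1))
    (Differentiable.diffContOnCl fun w ↦ (hd w).differentiableAt) (fun w hw ↦ hbd w hw (j + 1))
  rw [(hd z).deriv, norm_smul] at this
  have hj : ‖(j : ℂ) + 1‖ = (j : ℝ) + 1 := by
    exact_mod_cast Complex.norm_natCast (j + 1)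
  rwa [hj] at this

/-- A power-bounded operator with a Ritt estimate stays power-bounded under small perturbations. -/
theorem norm_add_smul_pow_le {Q T : 𝔸} (hQT : Commute Q T) {C N : ℝ}
    (hC : ∀ n : ℕ, ((n : ℝ) + 1) * ‖Q * T ^ n‖ ≤ C) (hN : ∀ n : ℕ, ‖T ^ n‖ ≤ N)
    {η : ℂ} (hη : ‖η‖ * (2 * C * Real.exp 1) ≤ 1 / 2) (n : ℕ) :
    ‖(T + η • Q) ^ n‖ ≤ 2 * N := by
  have hC0 : 0 ≤ C := le_trans (by positivity) (hC 0)
  have hN0 : 0 ≤ N := (norm_nonneg _).trans (hN 0)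
  have hterm (k : ℕ) (hk : k ∈ Finset.range (n + 1)) :
      ‖(η • Q) ^ k * T ^ (n - k) * (n.choose k : 𝔸)‖ ≤ (1 / 2) ^ k * N := by
    rcases Nat.eq_zero_or_pos k with rfl | hk0
    · simpa using hN n
    have hkn : k ≤ n := Nat.lt_succ_iff.1 (Finset.mem_range.1 hk)
    have hq1 : 1 ≤ n / k := (Nat.one_le_div_iff hk0).2 hkn
    -- Share `T ^ (n - k)` among the `k` factors `Q`, giving `k` blocks `Q T ^ q` with `q + 1 = ⌊n /
    -- k⌋`. Each block is at most `2 C k / n`; the powers of `n` cancel against the binomial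
    -- coefficient, and `k ^ k / k! ≤ e ^ k` leaves a geometric series.
    obtain ⟨q, hq⟩ : ∃ q, n / k = q + 1 := ⟨n / k - 1, by omega⟩
    have hqk : k * (q + 1) ≤ n := hq ▸ Nat.mul_div_le n k
    have hnq : n < k * (q + 2) := by
      have := Nat.lt_mul_div_succ n hk0
      rwa [hq] at this
    have hn2 : (n : ℝ) ≤ 2 * k * (q + 1) := by
      have : n ≤ 2 * k * (q + 1) := by nlinarith
      exact_mod_cast this
    have hn0 : (0 : ℝ) < n := by exact_mod_cast hk0.trans_le hkn
    have hk0' : (0 : ℝ) < k := by exact_mod_cast hk0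
    have e1 : Q ^ k * T ^ (n - k) = (Q * T ^ q) ^ k * T ^ (n - k * (q + 1)) := by
      rw [(hQT.pow_right q).mul_pow, mul_assoc, ← pow_mul, ← pow_add]
      congr 2
      rw [mul_add] at hqk ⊢
      rw [mul_comm q k]
      omega
    have e2 : ‖Q * T ^ q‖ ≤ 2 * C * k / n := by
      rw [le_div_iff₀ hn0]
      have h1 := mul_le_mul_of_nonneg_left (hC q) (by positivity : (0 : ℝ) ≤ 2 * k)
      have h2 := mul_le_mul_of_nonneg_left hn2 (norm_nonneg (Q * T ^ q))
      linarith
    have e3 : ‖Q ^ k * T ^ (n - k)‖ ≤ (2 * C * k / n) ^ k * N := by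
      rw [e1]
      refine (norm_mul_le _ _).trans (mul_le_mul ((norm_pow_le' _ hk0).trans ?_) (hN _)
        (norm_nonneg _) (by positivity))
      gcongr
    have e4 : (n.choose k : ℝ) ≤ n ^ k / k.factorial := Nat.choose_le_pow_div k n
    have e5 : (k : ℝ) ^ k / k.factorial ≤ Real.exp 1 ^ k := by
      rw [← Real.exp_nat_mul, mul_one]
      exact Real.pow_div_factorial_le_exp _ (by positivity) k
    rw [smul_pow, smul_mul_assoc, ← nsmul_eq_mul', ← Nat.cast_smul_eq_nsmul ℂ, norm_smul,
      norm_smul, norm_pow, Complex.norm_natCast]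
    calc (n.choose k : ℝ) * (‖η‖ ^ k * ‖Q ^ k * T ^ (n - k)‖)
        ≤ n ^ k / k.factorial * (‖η‖ ^ k * ((2 * C * k / n) ^ k * N)) := by gcongr
      _ = (‖η‖ * (2 * C)) ^ k * ((k : ℝ) ^ k / k.factorial) * N := by
          rw [div_pow, mul_pow, mul_pow ‖η‖ (2 * C)]; field_simp
      _ ≤ (‖η‖ * (2 * C)) ^ k * Real.exp 1 ^ k * N := by gcongr
      _ = (‖η‖ * (2 * C * Real.exp 1)) ^ k * N := by rw [← mul_pow, mul_assoc]
      _ ≤ (1 / 2) ^ k * N := by gcongr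
  rw [add_comm T, (hQT.smul_left η).add_pow]
  refine (norm_sum_le_of_le _ hterm).trans ?_
  rw [← Finset.sum_mul]
  gcongr
  exact sum_geometric_two_le _

variable [CompleteSpace 𝔸]

theorem exists_exp_eq_add_sq_mul (A : 𝔸) :
    ∃ B : 𝔸, NormedSpace.exp A = 1 + A + A * A * B := by
  have hs : Summable fun n : ℕ ↦ ((n + 2).factorial : ℂ)⁻¹ • A ^ n := by
    refine .of_norm_bounded (NormedSpace.norm_expSeries_summable' (𝕂 := ℂ) A) fun n ↦ ?_
    rw [norm_smul, norm_smul, norm_inv, norm_inv, Complex.norm_natCast, Complex.norm_natCast]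
    gcongr
    omega
  refine ⟨∑' n : ℕ, ((n + 2).factorial : ℂ)⁻¹ • A ^ n, ?_⟩
  have h := (NormedSpace.expSeries_summable' (𝕂 := ℂ) A).sum_add_tsum_nat_add 2
  rw [congr_fun (NormedSpace.exp_eq_tsum ℂ) A, ← h, ← hs.tsum_mul_left]
  congr 1
  · simp [Finset.sum_range_succ]
  · refine tsum_congr fun n ↦ ?_
    rw [mul_smul_comm, add_comm n 2, pow_add, pow_two]

theorem exp_natCast_smul (A : 𝔸) (m : ℕ) :
    NormedSpace.exp ((m : ℂ) • A) = NormedSpace.exp A ^ m := by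
  let +nondep : NormedAlgebra ℚ 𝔸 := .restrictScalars ℚ ℂ 𝔸
  rw [Nat.cast_smul_eq_nsmul, NormedSpace.exp_nsmul]

/-- Comparison of `(1 + A) ^ n` with `exp (n A)`. -/
theorem exists_norm_one_add_pow_le {A : 𝔸} {C M : ℝ}
    (hC : ∀ n : ℕ, ((n : ℝ) + 1) * ‖A * (1 + A) ^ n‖ ≤ C)
    (hM : ∀ t : ℝ, 0 ≤ t → ‖NormedSpace.exp ((t : ℂ) • A)‖ ≤ M) :
    ∃ N : ℝ, ∀ n : ℕ, ‖(1 + A) ^ n‖ ≤ N := by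
  have hC0 : 0 ≤ C := le_trans (by positivity) (hC 0)
  obtain ⟨B, hB⟩ := exists_exp_eq_add_sq_mul A
  set E := NormedSpace.exp A with hE
  have hAE : Commute A E := by simpa using commute_exp_smul 1 A
  have hT (k : ℕ) : ‖A * (1 + A) ^ k‖ ≤ C / ((k : ℝ) + 1) := by
    rw [le_div_iff₀ (by positivity), mul_comm]; exact hC k
  have hEm (m : ℕ) : ‖A * E ^ m‖ ≤ 2 * C / ((m : ℝ) + 1) := by
    rcases Nat.eq_zero_or_pos m with rfl | hm
    · have := hC 0
      simp at this ⊢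
      linarith
    · have hm' : (1 : ℝ) ≤ m := by exact_mod_cast hm
      have := norm_mul_exp_le_div hC (t := m) (by positivity)
      rw [Complex.ofReal_natCast, exp_natCast_smul] at this
      refine this.trans ?_
      rw [div_le_div_iff₀ (by positivity) (by positivity)]
      nlinarith
  refine ⟨M + 2 * C * C * ‖B‖, fun n ↦ ?_⟩
  -- Telescoping, with `E - (1 + A) = A² B`: one `A` goes to each power, so both decay bounds apply.
  have h1 : (1 + A) ^ n = E ^ n - ∑ i ∈ Finset.range n,
      (A * (1 + A) ^ i) * (A * E ^ (n - 1 - i)) * B := by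
    have hc : Commute (1 + A) E := (Commute.one_left _).add_left hAE
    have h2 : (1 + A) - E = -(A * A * B) := by rw [hB]; abel
    rw [eq_sub_iff_add_eq, ← eq_sub_iff_add_eq', ← neg_sub ((1 + A) ^ n), ← hc.geom_sum₂_mul,
      h2, mul_neg, neg_neg, Finset.sum_mul]
    refine Finset.sum_congr rfl fun i _ ↦ ?_
    have c1 : Commute A ((1 + A) ^ i) := ((Commute.one_right A).add_right (.refl A)).pow_right i
    have c2 : Commute A (E ^ (n - 1 - i)) := hAE.pow_right _
    calc A * (1 + A) ^ i * (A * E ^ (n - 1 - i)) * B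
        = (1 + A) ^ i * (A * A) * E ^ (n - 1 - i) * B := by rw [c1.eq]; simp only [mul_assoc]
      _ = (1 + A) ^ i * E ^ (n - 1 - i) * (A * A * B) := by
          rw [mul_assoc _ (A * A), (c2.mul_left c2).eq]; simp only [mul_assoc]
  have h3 : ‖E ^ n‖ ≤ M := by
    have := hM n (by positivity)
    rwa [Complex.ofReal_natCast, exp_natCast_smul] at this
  rw [h1]
  refine (norm_sub_le _ _).trans (add_le_add h3 ?_)
  rcases Nat.eq_zero_or_pos n with rfl | hn
  · simpa using by positivity
  have hn' : (0 : ℝ) < n := by exact_mod_cast hn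
  refine (norm_sum_le_of_le (n := fun _ ↦ 2 * C * C * ‖B‖ / n) _ fun i hi ↦ ?_).trans_eq ?_
  · have hi' : i + 1 ≤ n := Finset.mem_range.1 hi
    have hin : ((n - 1 - i : ℕ) : ℝ) + 1 = n - i := by
      rw [Nat.sub_sub, add_comm 1 i, Nat.cast_sub hi']; push_cast; ring
    have hE' := hEm (n - 1 - i)
    rw [hin] at hE'
    have hi2 : (i : ℝ) + 1 ≤ n := by exact_mod_cast hi'
    -- Each of the `n` terms is thus `O(1/n)`, so their sum stays bounded.
    have hprod : (n : ℝ) ≤ (i + 1) * (n - i) := by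
      have : (0 : ℝ) ≤ i := by positivity
      nlinarith
    have hni : (0 : ℝ) < n - i := by linarith
    calc ‖A * (1 + A) ^ i * (A * E ^ (n - 1 - i)) * B‖
        ≤ C / (i + 1) * (2 * C / (n - i)) * ‖B‖ := by
          refine (norm_mul_le _ _).trans ?_
          gcongr
          exact (norm_mul_le _ _).trans (mul_le_mul (hT i) hE' (norm_nonneg _) (by positivity))
      _ = 2 * C * C * ‖B‖ / ((i + 1) * (n - i)) := by field_simp
      _ ≤ 2 * C * C * ‖B‖ / n := by gcongr
  · rw [Finset.sum_const, Finset.card_range, nsmul_eq_mul]; field_simp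

/-- Morally `R = ∫₀^∞ exp (-t D) dt`. The integral is replaced by comparing `exp (-t D) R`, whose
derivative is `-exp (-t D)`, with a scalar primitive of the bound. -/
theorem norm_le_of_mul_eq_one {D R : 𝔸} (hDR : D * R = 1) {M ρ : ℝ} (hρ : 0 < ρ)
    (hM : ∀ t : ℝ, 0 ≤ t → ‖NormedSpace.exp ((t : ℂ) • (-D))‖ ≤ M * Real.exp (-(ρ * t))) :
    ‖R‖ ≤ M / ρ := by
  have hM0 : 0 ≤ M := by simpa using (norm_nonneg _).trans (hM 0 le_rfl)
  set g : ℝ → 𝔸 := fun t ↦ NormedSpace.exp ((t : ℂ) • (-D)) * R with hg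
  have hd (t : ℝ) : HasDerivAt g (-NormedSpace.exp ((t : ℂ) • (-D))) t := by
    have h := (hasDerivAt_exp_line (-D) 0 1 t).mul_const R
    have hc := (commute_exp_smul (t : ℂ) (-D)).eq
    simp only [zero_add, mul_one, one_smul] at h
    rw [hc, mul_assoc, neg_mul, hDR, mul_neg, mul_one] at h
    exact h
  have hB (t : ℝ) : HasDerivAt (fun t ↦ M / ρ * (1 - Real.exp (-(ρ * t))))
      (M * Real.exp (-(ρ * t))) t := by
    have h := ((((hasDerivAt_id' t).const_mul ρ).neg.exp).const_sub 1).const_mul (M / ρ)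
    have e : M * Real.exp (-(ρ * t)) = M / ρ * -(Real.exp (-(ρ * t)) * -(ρ * 1)) := by field_simp
    rw [e]
    exact h
  have key (T : ℝ) (hT : 0 ≤ T) : ‖g T - g 0‖ ≤ M / ρ := by
    have := image_norm_le_of_norm_deriv_right_le_deriv_boundary (f := fun t ↦ g t - g 0)
      (a := 0) (b := T) (fun t _ ↦ ((hd t).sub_const _).continuousAt.continuousWithinAt)
      (fun t _ ↦ ((hd t).sub_const _).hasDerivWithinAt) (by simp) hB
      (fun t ht ↦ by rw [norm_neg]; exact hM t ht.1) (Set.right_mem_Icc.2 hT)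
    refine this.trans (mul_le_of_le_one_right (by positivity) ?_)
    linarith [Real.exp_pos (-(ρ * T))]
  have hg0 : g 0 = R := by simp [hg]
  have hlim : Tendsto g atTop (𝓝 0) := by
    refine squeeze_zero_norm' (a := fun t ↦ M * Real.exp (-(ρ * t)) * ‖R‖) ?_ ?_
    · filter_upwards [eventually_ge_atTop 0] with t ht
      exact (norm_mul_le _ _).trans (by gcongr; exact hM t ht)
    · have : Tendsto (fun t ↦ Real.exp (-(ρ * t))) atTop (𝓝 0) :=
        Real.tendsto_exp_neg_atTop_nhds_zero.comp (tendsto_id.const_mul_atTop hρ)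
      simpa using (this.const_mul M).mul_const ‖R‖
  have := le_of_tendsto ((hlim.sub_const (g 0)).norm)
    ((eventually_ge_atTop 0).mono fun T hT ↦ key T hT)
  simpa [hg0] using this

/-- Gelfand's formula gives `‖A ^ n‖ ≤ K ε ^ n`, so the exponential has minimal exponential type. -/
theorem exists_norm_exp_smul_le_of_spectrum_eq {A : 𝔸} (hA : spectrum ℂ A = {0}) {ε : ℝ}
    (hε : 0 < ε) : ∃ K : ℝ, ∀ c : ℂ, ‖NormedSpace.exp (c • A)‖ ≤ K * Real.exp (ε * ‖c‖) := by
  have hr : spectralRadius ℂ A = 0 := by simp [spectralRadius, hA]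
  have h1 := spectrum.pow_norm_pow_one_div_tendsto_nhds_spectralRadius A
  rw [hr] at h1
  have h2 : ∀ᶠ n : ℕ in atTop, ‖A ^ n‖ ≤ ε ^ n := by
    filter_upwards [h1.eventually_lt_const (ENNReal.ofReal_pos.2 hε), eventually_gt_atTop 0]
      with n hn hn0
    rw [ENNReal.ofReal_lt_ofReal_iff hε] at hn
    have := pow_le_pow_left₀ (by positivity) hn.le n
    rwa [one_div, Real.rpow_inv_natCast_pow (norm_nonneg _) hn0.ne'] at this
  obtain ⟨n₀, hn₀⟩ := eventually_atTop.1 h2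
  set K : ℝ := 1 + ∑ n ∈ Finset.range n₀, ‖A ^ n‖ / ε ^ n with hK
  have hK1 : 1 ≤ K := by
    rw [hK]; exact le_add_of_nonneg_right (Finset.sum_nonneg fun _ _ ↦ by positivity)
  have hK2 (n : ℕ) : ‖A ^ n‖ ≤ K * ε ^ n := by
    rcases le_or_gt n₀ n with h | h
    · exact (hn₀ n h).trans (le_mul_of_one_le_left (by positivity) hK1)
    · rw [← div_le_iff₀ (by positivity), hK]
      have := Finset.single_le_sum (f := fun n ↦ ‖A ^ n‖ / ε ^ n) (fun _ _ ↦ by positivity)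
        (Finset.mem_range.2 h)
      linarith
  refine ⟨K, fun c ↦ ?_⟩
  refine (NormedSpace.exp_series_hasSum_exp' (𝕂 := ℂ) (c • A)).norm_le_of_bounded
    ((hasSum_pow_div_factorial (ε * ‖c‖)).mul_left K) fun n ↦ ?_
  rw [smul_pow, norm_smul, norm_smul, norm_inv, norm_pow, Complex.norm_natCast, mul_pow]
  calc (n.factorial : ℝ)⁻¹ * (‖c‖ ^ n * ‖A ^ n‖)
      ≤ (n.factorial : ℝ)⁻¹ * (‖c‖ ^ n * (K * ε ^ n)) := by gcongr; exact hK2 n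
    _ = K * (ε ^ n * ‖c‖ ^ n / n.factorial) := by ring

/-- The factor `exp (-ε w)` makes the function bounded on the positive axis without changing norms
on the imaginary axis. Phragmén–Lindelöf applies, and then `ε → 0`. -/
theorem norm_exp_smul_le_of_re_nonneg {A : 𝔸} (hA : spectrum ℂ A = {0}) {M : ℝ}
    (hM : ∀ x : ℝ, ‖NormedSpace.exp ((x * Complex.I) • A)‖ ≤ M) {w : ℂ} (hw : 0 ≤ w.re) :
    ‖NormedSpace.exp (w • A)‖ ≤ M := by
  have hdiff : Differentiable ℂ fun w : ℂ ↦ NormedSpace.exp (w • A) := fun w ↦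
    (hasDerivAt_exp_smul_const (𝕂 := ℂ) A w).differentiableAt
  have key (ε : ℝ) (hε : 0 < ε) : ‖NormedSpace.exp (w • A)‖ ≤ M * Real.exp (ε * w.re) := by
    obtain ⟨K, hK⟩ := exists_norm_exp_smul_le_of_spectrum_eq hA hε
    have hg (w : ℂ) : ‖Complex.exp (-(ε * w)) • NormedSpace.exp (w • A)‖ =
        Real.exp (-(ε * w.re)) * ‖NormedSpace.exp (w • A)‖ := by
      rw [norm_smul, Complex.norm_exp]; simp
    have := PhragmenLindelof.right_half_plane_of_bounded_on_real (C := M)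
      (f := fun w : ℂ ↦ Complex.exp (-(ε * w)) • NormedSpace.exp (w • A))
      (Differentiable.diffContOnCl (Differentiable.fun_smul (c := fun w : ℂ ↦ Complex.exp (-(ε * w)))
        (by fun_prop) hdiff))
      ⟨1, one_lt_two, ε, ?_⟩ ⟨K, ?_⟩ (fun x ↦ ?_) hw
    · rw [hg, Real.exp_neg, inv_mul_le_iff₀ (Real.exp_pos _)] at this
      linarith
    · refine Asymptotics.IsBigO.of_bound K ?_
      refine (eventually_principal.2 fun w hw ↦ ?_).filter_mono inf_le_right
      rw [hg, Real.norm_of_nonneg (Real.exp_pos _).le, Real.rpow_one]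
      refine (mul_le_of_le_one_left (norm_nonneg _) ?_).trans (hK w)
      have hw' : 0 < w.re := hw
      exact Real.exp_le_one_iff.2 (by nlinarith)
    · rw [eventually_map]
      filter_upwards [eventually_ge_atTop 0] with x hx
      rw [hg, Real.exp_neg, inv_mul_le_iff₀ (Real.exp_pos _), mul_comm]
      have := hK x
      rwa [Complex.norm_real, Real.norm_of_nonneg hx] at this
    · rw [hg]
      simpa using hM x
  have hlim : Tendsto (fun ε : ℝ ↦ M * Real.exp (ε * w.re)) (𝓝[>] 0) (𝓝 M) := by
    refine tendsto_nhdsWithin_of_tendsto_nhds (Continuous.tendsto' (by fun_prop) _ _ (by simp))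
  exact ge_of_tendsto hlim (eventually_nhdsWithin_of_forall fun ε hε ↦ key ε hε)

/-- A quasinilpotent generator of a bounded group vanishes. -/
theorem eq_zero_of_norm_exp_le {A : 𝔸} (hA : spectrum ℂ A = {0}) {M : ℝ}
    (hM : ∀ x : ℝ, ‖NormedSpace.exp ((x * Complex.I) • A)‖ ≤ M) : A = 0 := by
  have hneg : spectrum ℂ (-A) = {0} := by rw [← spectrum.neg_eq, hA]; simp
  have hbd (w : ℂ) : ‖NormedSpace.exp (w • A)‖ ≤ M := by
    rcases le_total 0 w.re with h | h
    · exact norm_exp_smul_le_of_re_nonneg hA hM h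
    · have := norm_exp_smul_le_of_re_nonneg hneg (M := M) (w := -w) (fun x ↦ ?_) (by simpa using h)
      · simpa using this
      · simpa using hM (-x)
  have hconst := Differentiable.apply_eq_apply_of_bounded (f := fun w : ℂ ↦ NormedSpace.exp (w • A))
    (fun w ↦ (hasDerivAt_exp_smul_const (𝕂 := ℂ) A w).differentiableAt)
    (isBounded_iff_forall_norm_le.2 ⟨M, by rintro _ ⟨w, rfl⟩; exact hbd w⟩)
  have h1 : HasDerivAt (fun w : ℂ ↦ NormedSpace.exp (w • A)) A 0 := by
    simpa using hasDerivAt_exp_smul_const (𝕂 := ℂ) A 0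
  have h2 : HasDerivAt (fun w : ℂ ↦ NormedSpace.exp (w • A)) 0 0 := by
    have : (fun w : ℂ ↦ NormedSpace.exp (w • A)) = fun _ ↦ NormedSpace.exp ((0 : ℂ) • A) :=
      funext fun w ↦ hconst w 0
    rw [this]
    exact hasDerivAt_const _ _
  exact h1.unique h2

end BanachAlgebra
end Microspectral

/-! ### Positive operators on ordered function spaces. -/

namespace Microspectral

section FunctionSpace

variable {Ω X : Type*} [NormedAddCommGroup X] [NormedSpace ℂ X] {ev : X →ₗ[ℂ] (Ω → ℂ)}

theorem IsOrderedComplexFunctionSpace.exists_conjugation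
    (hX : IsOrderedComplexFunctionSpace ev) :
    ∃ J : X →ₛₗᵢ[starRingEnd ℂ] X, (∀ x ω, ev (J x) ω = conj (ev x ω)) ∧ ∀ x, J (J x) = x := by
  choose f hf using hX.exists_conj
  have ext (x y : X) (h : ∀ ω, ev x ω = ev y ω) : x = y := hX.injective (funext h)
  refine ⟨⟨⟨⟨f, fun x y ↦ ext _ _ fun ω ↦ ?_⟩, fun c x ↦ ext _ _ fun ω ↦ ?_⟩,
    fun x ↦ (hf x).2⟩, fun x ↦ (hf x).1, fun x ↦ ext _ _ fun ω ↦ ?_⟩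
  · simp [(hf _).1]
  · simp [(hf _).1]
  · change ev (f (f x)) ω = _
    simp [(hf _).1]

namespace IsPositiveReal

variable {P A B : X →L[ℂ] X}

theorem add (hA : IsPositiveReal ev A) (hB : IsPositiveReal ev B) : IsPositiveReal ev (A + B) :=
  fun x hx ω ↦ by simpa using add_nonneg (hA x hx ω) (hB x hx ω)

theorem mul (hA : IsPositiveReal ev A) (hB : IsPositiveReal ev B) : IsPositiveReal ev (A * B) :=
  fun x hx ↦ hA _ (hB x hx)

theorem one : IsPositiveReal ev (1 : X →L[ℂ] X) := fun _ hx ↦ hx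

theorem pow (hA : IsPositiveReal ev A) (n : ℕ) : IsPositiveReal ev (A ^ n) := by
  induction n with
  | zero => exact one
  | succ n ih => rw [pow_succ]; exact ih.mul hA

theorem smul {c : ℂ} (hc : 0 ≤ c) (hA : IsPositiveReal ev A) : IsPositiveReal ev (c • A) :=
  fun x hx ω ↦ by simpa using mul_nonneg hc (hA x hx ω)

theorem sum {ι : Type*} {s : Finset ι} {f : ι → X →L[ℂ] X}
    (hf : ∀ i ∈ s, IsPositiveReal ev (f i)) : IsPositiveReal ev (∑ i ∈ s, f i) :=
  Finset.sum_induction f (IsPositiveReal ev) (fun _ _ ↦ add) (fun x _ ω ↦ by simp) hf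

variable (hX : IsOrderedComplexFunctionSpace ev)
include hX

/-- A real `u` is the difference of the positive elements `|u|` and `|u| - u`. -/
theorem im_eq_zero (hP : IsPositiveReal ev P) {u : X} (hu : ∀ ω, (ev u ω).im = 0) (ω : Ω) :
    (ev (P u) ω).im = 0 := by
  obtain ⟨a, ha, -⟩ := hX.exists_abs u
  have h1 := hP a (fun ω ↦ by rw [ha]; exact_mod_cast norm_nonneg _) ω
  have h2 := hP (a - u) (fun ω ↦ ?_) ω
  · have e1 := (Complex.nonneg_iff.1 h1).2
    have e2 := (Complex.nonneg_iff.1 h2).2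
    simp only [map_sub, Pi.sub_apply, Complex.sub_im] at e2
    linarith
  · simp only [map_sub, Pi.sub_apply, ha, sub_nonneg, Complex.le_def, Complex.ofReal_re,
      Complex.ofReal_im, hu, and_true]
    exact Complex.re_le_norm _

theorem apply_conjugation (hP : IsPositiveReal ev P) {J : X →ₛₗᵢ[starRingEnd ℂ] X}
    (hJ : ∀ x ω, ev (J x) ω = conj (ev x ω)) (x : X) : P (J x) = J (P x) := by
  refine hX.injective (funext fun ω ↦ ?_)
  have h1 := hP.im_eq_zero hX (u := x + J x) (fun ω ↦ by simp [hJ]) ω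
  have h2 := hP.im_eq_zero hX (u := Complex.I • (x - J x)) (fun ω ↦ by simp [hJ]) ω
  simp only [map_add, map_sub, map_smul, Pi.add_apply, Pi.sub_apply, Pi.smul_apply, smul_eq_mul,
    Complex.add_im, Complex.I_mul_im, Complex.sub_re] at h1 h2
  rw [hJ]
  apply Complex.ext
  · rw [Complex.conj_re]; linarith
  · rw [Complex.conj_im]; linarith

theorem norm_apply_le (hA : IsPositiveReal ev A) {x a : X}
    (ha : ∀ ω, ev a ω = ((‖ev x ω‖ : ℝ) : ℂ)) (ω : Ω) :
    ((‖ev (A x) ω‖ : ℝ) : ℂ) ≤ ev (A a) ω := by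
  obtain ⟨J, hJ, -⟩ := hX.exists_conjugation
  have ha0 (ω : Ω) : 0 ≤ ev a ω := by rw [ha]; exact_mod_cast norm_nonneg _
  set v := ev (A x) ω with hv
  rcases eq_or_ne v 0 with h0 | h0
  · rw [h0]; simpa using hA a ha0 ω
  have hv0 : ‖v‖ ≠ 0 := norm_ne_zero_iff.2 h0
  -- Rotate `x` so that `A x` becomes nonnegative at `ω`, then apply `A` to `2 (|x| - Re (c x)) ≥
  -- 0`.
  set c : ℂ := conj v / ‖v‖ with hc
  have hc1 : ‖c‖ = 1 := by rw [hc, norm_div]; simp [hv0]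
  have hcv : c * v = ‖v‖ := by
    have : (‖v‖ : ℂ) ≠ 0 := by exact_mod_cast hv0
    rw [hc, div_mul_eq_mul_div, Complex.conj_mul', pow_two, mul_div_assoc, div_self this, mul_one]
  have h := hA ((2 : ℂ) • a - (c • x + J (c • x))) (fun ω ↦ ?_) ω
  · rw [map_sub, map_smul, map_add, hA.apply_conjugation hX hJ, map_smul] at h
    simp only [map_sub, map_smul, map_add, Pi.sub_apply, Pi.smul_apply, Pi.add_apply, hJ,
      smul_eq_mul] at h
    rw [← hv, hcv, Complex.conj_ofReal] at h
    rw [← sub_nonneg] at h ⊢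
    have h2 := mul_nonneg (by norm_num [Complex.nonneg_iff] : (0 : ℂ) ≤ 1 / 2) h
    convert h2 using 1
    ring
  · simp only [map_sub, map_smul, map_add, Pi.sub_apply, Pi.smul_apply, Pi.add_apply, hJ,
      smul_eq_mul, ha, Complex.add_conj, sub_nonneg]
    have h1 : (c * ev x ω).re ≤ ‖ev x ω‖ := by
      simpa [norm_mul, hc1] using Complex.re_le_norm (c * ev x ω)
    exact_mod_cast mul_le_mul_of_nonneg_left h1 (by norm_num : (0 : ℝ) ≤ 2)

/-- `|A x| ≤ A |x| ≤ B |x|` pointwise, and the norm is monotone. -/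
theorem norm_le (hA : IsPositiveReal ev A) (hAB : IsPositiveReal ev (B - A)) : ‖A‖ ≤ ‖B‖ := by
  refine A.opNorm_le_bound (norm_nonneg _) fun x ↦ ?_
  obtain ⟨a, ha, hna⟩ := hX.exists_abs x
  obtain ⟨b, hb, hnb⟩ := hX.exists_abs (A x)
  have ha0 (ω : Ω) : 0 ≤ ev a ω := by rw [ha]; exact_mod_cast norm_nonneg _
  rw [← hnb, ← hna]
  refine (hX.norm_mono b (B a) fun ω ↦ ?_).trans (B.le_opNorm a)
  rw [hb]
  refine ⟨by exact_mod_cast norm_nonneg _, (hA.norm_apply_le hX ha ω).trans ?_⟩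
  simpa using hAB a ha0 ω

variable [CompleteSpace X]

/-- Each term of the exponential series of a positive operator is dominated by its sum. -/
theorem norm_term_le_norm_exp (hA : IsPositiveReal ev A) (hB : IsPositiveReal ev B) (j : ℕ) :
    ‖((j.factorial : ℂ)⁻¹ • A ^ j) * B‖ ≤ ‖NormedSpace.exp A * B‖ := by
  have hlim := ((NormedSpace.exp_series_hasSum_exp' (𝕂 := ℂ) A).mul_right B).tendsto_sum_nat.norm
  have hterm (k : ℕ) : IsPositiveReal ev (((k.factorial : ℂ)⁻¹ • A ^ k) * B) :=
    ((hA.pow k).smul (by rw [← Complex.ofReal_natCast, ← Complex.ofReal_inv]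
                         exact_mod_cast by positivity)).mul hB
  -- Only partial sums are compared and only norms pass to the limit, so closedness of the positive
  -- cone is not needed.
  refine ge_of_tendsto hlim ((eventually_gt_atTop j).mono fun N hN ↦ ?_)
  refine (hterm j).norm_le hX ?_
  rw [← Finset.sum_erase_eq_sub (Finset.mem_range.2 hN)]
  exact sum fun k _ ↦ hterm k

/-- The antilinear isometry `J` commutes with `P`, so conjugating by it replaces `c` by its
conjugate. -/
theorem norm_pow_mul_exp_conj_le (hP : IsPositiveReal ev P) (k : ℕ) (c : ℂ) :
    ‖P ^ k * NormedSpace.exp (conj c • P)‖ ≤ ‖P ^ k * NormedSpace.exp (c • P)‖ := by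
  obtain ⟨J, hJ, hJJ⟩ := hX.exists_conjugation
  have hpow (n : ℕ) (x : X) : (P ^ n) (J x) = J ((P ^ n) x) := (hP.pow n).apply_conjugation hX hJ x
  have hexp (x : X) : NormedSpace.exp (conj c • P) (J x) = J (NormedSpace.exp (c • P) x) := by
    have h1 := (NormedSpace.exp_series_hasSum_exp' (𝕂 := ℂ) (conj c • P)).mapL
      (ContinuousLinearMap.apply ℂ X (J x))
    have h2 := ((NormedSpace.exp_series_hasSum_exp' (𝕂 := ℂ) (c • P)).mapL
      (ContinuousLinearMap.apply ℂ X x)).mapL J.toContinuousLinearMap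
    refine h1.unique (h2.congr_fun fun n ↦ ?_)
    simp [smul_pow, hpow]
  refine ContinuousLinearMap.opNorm_le_bound _ (norm_nonneg _) fun x ↦ ?_
  have : (P ^ k * NormedSpace.exp (conj c • P)) x =
      J ((P ^ k * NormedSpace.exp (c • P)) (J x)) := by
    rw [mul_apply_eq_comp, mul_apply_eq_comp, ← hpow, ← hexp, hJJ]
  rw [this, J.norm_map]
  exact ((P ^ k * NormedSpace.exp (c • P)).le_opNorm _).trans_eq (by rw [J.norm_map])

/-- A positive operator `P` with `P exp (t w P) → 0` forces `w` into the left half-plane. -/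
theorem re_neg_of_tendsto (hP : IsPositiveReal ev P) (hP0 : P ≠ 0) {w : ℂ}
    (h : Tendsto (fun t : ℝ ↦ ‖P * NormedSpace.exp ((t : ℂ) • (w • P))‖) atTop (𝓝 0)) :
    w.re < 0 := by
  by_contra! hw
  have hsq : P * P = 0 := by
    rw [← norm_le_zero_iff, ← mul_zero (0 : ℝ)]
    refine ge_of_tendsto (h.mul h) ((eventually_ge_atTop 0).mono fun t ht ↦ ?_)
    have h0 : (0 : ℂ) ≤ ((t * (2 * w.re) : ℝ) : ℂ) := by exact_mod_cast by positivity
    -- If `Re w ≥ 0`, the zeroth term `P²` is dominated by `exp (2 t (Re w) P) P²`, which tends to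
    -- `0`.
    have h1 := (hP.smul h0).norm_term_le_norm_exp hX (hP.mul hP) 0
    simp only [Nat.factorial_zero, Nat.cast_one, inv_one, pow_zero, one_smul, one_mul] at h1
    have h2 := hP.norm_pow_mul_exp_conj_le hX 1 ((t : ℂ) * w)
    rw [pow_one] at h2
    rw [smul_smul]
    have e : ((t * (2 * w.re) : ℝ) : ℂ) = (t : ℂ) * w + conj ((t : ℂ) * w) := by
      rw [Complex.add_conj]; simp; ring
    rw [← ((commute_exp_smul _ P).mul_left (commute_exp_smul _ P)).eq, e] at h1
    exact h1.trans ((norm_sq_mul_exp_add_smul_le _ _ P).trans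
      (mul_le_mul_of_nonneg_left h2 (norm_nonneg _)))
  -- Once `P² = 0`, `P exp (t w P) = P` for every `t`.
  refine hP0 (norm_le_zero_iff.1 (ge_of_tendsto h (Eventually.of_forall fun t ↦ le_of_eq ?_)))
  obtain ⟨B, hB⟩ := exists_exp_eq_add_sq_mul ((t : ℂ) • (w • P))
  rw [hB]
  simp [mul_add, hsq]

/-- The linear term of the series alone grows like `t r ‖P‖`. -/
theorem eq_zero_of_norm_exp_le (hP : IsPositiveReal ev P) {r M : ℝ} (hr : 0 < r)
    (hM : ∀ t : ℝ, 0 ≤ t → ‖NormedSpace.exp (((t * r : ℝ) : ℂ) • P)‖ ≤ M) : P = 0 := by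
  by_contra hP0
  have h1 (t : ℝ) (ht : 0 ≤ t) : t * r * ‖P‖ ≤ M := by
    have h0 : (0 : ℂ) ≤ ((t * r : ℝ) : ℂ) := by exact_mod_cast by positivity
    have := (hP.smul h0).norm_term_le_norm_exp hX one 1
    simp only [Nat.factorial_one, Nat.cast_one, inv_one, pow_one, one_smul, mul_one] at this
    rw [norm_smul, Complex.norm_real, Real.norm_of_nonneg (by positivity)] at this
    exact this.trans (hM t ht)
  have hpos : 0 < r * ‖P‖ := mul_pos hr (norm_pos_iff.2 hP0)
  have hM0 : 0 ≤ M := (norm_nonneg _).trans (hM 0 le_rfl)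
  have h2 := h1 ((M + 1) / (r * ‖P‖)) (by positivity)
  have h3 : (M + 1) / (r * ‖P‖) * r * ‖P‖ = M + 1 := by rw [mul_assoc, div_mul_cancel₀ _ hpos.ne']
  linarith

/-- If `exp (t w P)` is bounded for some `w ≠ 0`, then `exp (-t P)` is bounded. -/
theorem exists_norm_exp_neg_le (hP : IsPositiveReal ev P) (hP0 : P ≠ 0)
    (hspec : spectrum ℂ P = {0}) {w : ℂ} (hw : w ≠ 0) {M : ℝ}
    (hM : ∀ t : ℝ, 0 ≤ t → ‖NormedSpace.exp ((t : ℂ) • (w • P))‖ ≤ M) :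
    ∃ N : ℝ, ∀ t : ℝ, 0 ≤ t → ‖NormedSpace.exp ((t : ℂ) • (-P))‖ ≤ N := by
  have hM0 : 0 ≤ M := (norm_nonneg _).trans (hM 0 le_rfl)
  have hconj (t : ℝ) (ht : 0 ≤ t) : ‖NormedSpace.exp (((t : ℂ) * conj w) • P)‖ ≤ M := by
    have h := hP.norm_pow_mul_exp_conj_le hX 0 ((t : ℂ) * w)
    rw [pow_zero, one_mul, one_mul, map_mul, Complex.conj_ofReal] at h
    exact h.trans (by simpa only [smul_smul] using hM t ht)
  have hre (t : ℝ) (ht : 0 ≤ t) : ‖NormedSpace.exp (((t * (2 * w.re) : ℝ) : ℂ) • P)‖ ≤ M * M := by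
    have e : ((t * (2 * w.re) : ℝ) : ℂ) = (t : ℂ) * w + (t : ℂ) * conj w := by
      rw [← mul_add, Complex.add_conj]; simp
    rw [e]
    exact (norm_exp_add_smul_le _ _ P).trans (mul_le_mul (by simpa only [smul_smul] using hM t ht)
      (hconj t ht) (norm_nonneg _) hM0)
  rcases lt_trichotomy w.re 0 with h | h | h
  · refine ⟨M * M, fun t ht ↦ ?_⟩
    have := hre (t / (-(2 * w.re))) (div_nonneg ht (by linarith))
    have e : t / (-(2 * w.re)) * (2 * w.re) = -t := by
      have := h.ne
      field_simp
    rw [e] at this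
    simpa using this
  · refine absurd ?_ hP0
    have him : w = w.im * Complex.I := by apply Complex.ext <;> simp [h]
    have him0 : (w.im : ℂ) ≠ 0 := fun h0 ↦ hw (by rw [him, h0, zero_mul])
    have : Nontrivial (X →L[ℂ] X) := ⟨P, 0, hP0⟩
    have hspec' : spectrum ℂ ((w.im : ℂ) • P) = {0} := by
      rw [spectrum.smul_eq_smul _ _ (by rw [hspec]; exact Set.singleton_nonempty 0), hspec]
      simp
    refine (smul_eq_zero.1 (Microspectral.eq_zero_of_norm_exp_le hspec' (M := M)
      fun x ↦ ?_)).resolve_left him0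
    -- For imaginary `w`, conjugation reverses time, so the semigroup bound becomes a group bound.
    rw [smul_smul, mul_assoc, mul_comm Complex.I, ← him]
    rcases le_total 0 x with hx | hx
    · simpa only [smul_smul] using hM x hx
    · have := hconj (-x) (by linarith)
      have e : ((-x : ℝ) : ℂ) * conj w = x * w := by
        rw [him]; simp
      rwa [e] at this
  · exact absurd (hP.eq_zero_of_norm_exp_le hX (by positivity : 0 < 2 * w.re) hre) hP0

end IsPositiveReal
end FunctionSpace
end Microspectral

/-! ### The Abel, Tauberian, power-bounded and semigroup sets, and the conclusion. -/

namespace Microspectral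

theorem exists_eventually_le_of_limsup_lt {ι : Type*} {l : Filter ι} {f : ι → ℝ}
    (h : limsup (fun i ↦ ENNReal.ofReal (f i)) l < ∞) : ∃ C : ℝ, ∀ᶠ i in l, f i ≤ C := by
  obtain ⟨b, hb, hb'⟩ := ENNReal.lt_iff_exists_real_btwn.1 h
  refine ⟨b, (eventually_lt_of_limsup_lt hb'.1).mono fun i hi ↦ ?_⟩
  exact ((ENNReal.ofReal_lt_ofReal_iff').1 hi).1.le

theorem limsup_lt_of_eventually_le {ι : Type*} {l : Filter ι} {f : ι → ℝ} {C : ℝ}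
    (h : ∀ᶠ i in l, f i ≤ C) : limsup (fun i ↦ ENNReal.ofReal (f i)) l < ∞ :=
  (limsup_le_of_le (h := h.mono fun _ hi ↦ ENNReal.ofReal_le_ofReal hi)).trans_lt
    ENNReal.ofReal_lt_top

section Sets

variable {X : Type*} [NormedAddCommGroup X] [NormedSpace ℂ X] {Q : X →L[ℂ] X} {z : ℂ}

theorem mem_tauberianSet_iff {α : ℝ} : z ∈ tauberianSet Q α ↔
    ∃ C : ℝ, ∀ j : ℕ, ((j : ℝ) + 1) ^ α * ‖(z • Q) * (1 + z • Q) ^ j‖ ≤ C := by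
  refine ⟨fun h ↦ ?_, fun ⟨C, hC⟩ ↦ limsup_lt_of_eventually_le (Eventually.of_forall hC)⟩
  obtain ⟨C, hC⟩ := exists_eventually_le_of_limsup_lt h
  obtain ⟨B, hB⟩ := (IsBoundedUnder.bddAbove_range (isBoundedUnder_of_eventually_le hC))
  exact ⟨B, fun j ↦ hB (Set.mem_range_self j)⟩

theorem mem_powerBoundedSet_iff :
    z ∈ powerBoundedSet Q ↔ ∃ N : ℝ, ∀ j : ℕ, ‖(1 + z • Q) ^ j‖ ≤ N := by
  refine ⟨fun ⟨N, hN⟩ ↦ ⟨max N ‖(1 : X →L[ℂ] X)‖, fun j ↦ ?_⟩, fun ⟨N, hN⟩ ↦ ⟨N, fun j _ ↦ hN j⟩⟩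
  rcases Nat.eq_zero_or_pos j with rfl | hj
  · rw [pow_zero]; exact le_max_right _ _
  · exact (hN j hj).trans (le_max_left _ _)

theorem tauberianSet_one_subset : tauberianSet Q 1 ⊆ tauberianSet Q (1 / 2) := by
  intro z hz
  obtain ⟨C, hC⟩ := mem_tauberianSet_iff.1 hz
  refine mem_tauberianSet_iff.2 ⟨C, fun j ↦ le_trans ?_ (hC j)⟩
  gcongr
  · linarith [(Nat.cast_nonneg j : (0 : ℝ) ≤ j)]
  · norm_num

theorem interior_powerBoundedSet_subset :
    interior (powerBoundedSet Q) ⊆ tauberianSet Q 1 := by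
  intro z hz
  have hset : powerBoundedSet Q = {w : ℂ | ∃ N : ℝ, ∀ j : ℕ, ‖(1 + w • Q) ^ j‖ ≤ N} :=
    Set.ext fun _ ↦ mem_powerBoundedSet_iff
  rw [hset] at hz
  obtain ⟨C, hC⟩ := exists_ritt_of_mem_interior hz
  refine mem_tauberianSet_iff.2 ⟨‖z‖ * C, fun j ↦ ?_⟩
  rw [Real.rpow_one, smul_mul_assoc, norm_smul, mul_left_comm]
  gcongr
  exact hC j

theorem exists_norm_exp_le_of_mem_semigroupSet [CompleteSpace X] (hz : z ∈ semigroupSet Q) :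
    ∃ M : ℝ, ∀ t : ℝ, 0 ≤ t → ‖NormedSpace.exp ((t : ℂ) • (z • Q))‖ ≤ M := by
  obtain ⟨C, hC⟩ := exists_eventually_le_of_limsup_lt hz
  obtain ⟨T, hT⟩ := eventually_atTop.1 hC
  have hcont : Continuous fun t : ℝ ↦ ‖NormedSpace.exp ((t : ℂ) • (z • Q))‖ :=
    ((continuous_exp_smul (z • Q)).comp Complex.continuous_ofReal).norm
  obtain ⟨B, hB⟩ := (isCompact_Icc (a := (0 : ℝ)) (b := T)).bddAbove_image hcont.continuousOn
  refine ⟨max B C, fun t ht ↦ ?_⟩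
  rcases le_total t T with h | h
  · exact (hB (Set.mem_image_of_mem _ ⟨ht, h⟩)).trans (le_max_left _ _)
  · rw [smul_smul]
    exact (hT t h).trans (le_max_right _ _)

variable {Ω : Type*} {ev : X →ₗ[ℂ] (Ω → ℂ)} {P : X →L[ℂ] X} {w : ℂ} [CompleteSpace X]

theorem IsPositiveReal.re_neg_of_mem_tauberianSet (hP : IsPositiveReal ev P)
    (hX : IsOrderedComplexFunctionSpace ev) (hP0 : P ≠ 0) (hw : w ≠ 0)
    (h : w ∈ tauberianSet P (1 / 2)) : w.re < 0 := by
  obtain ⟨C, hC⟩ := mem_tauberianSet_iff.1 h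
  simp only [← Real.sqrt_eq_rpow] at hC
  refine hP.re_neg_of_tendsto hX hP0 ?_
  have hb (t : ℝ) (ht : 0 < t) :
      ‖P * NormedSpace.exp ((t : ℂ) • (w • P))‖ ≤ C / √t / ‖w‖ := by
    have := norm_mul_exp_le_div_sqrt hC ht
    rwa [smul_mul_assoc, norm_smul, ← le_div_iff₀' (norm_pos_iff.2 hw)] at this
  refine squeeze_zero' (Eventually.of_forall fun _ ↦ norm_nonneg _)
    ((eventually_gt_atTop 0).mono hb) ?_
  have h0 : Tendsto (fun t : ℝ ↦ C / √t) atTop (𝓝 0) :=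
    tendsto_const_nhds.div_atTop Real.tendsto_sqrt_atTop
  simpa using h0.div_const ‖w‖

theorem IsPositiveReal.mem_interior_of_mem_tauberianSet (hP : IsPositiveReal ev P)
    (hX : IsOrderedComplexFunctionSpace ev) (hP0 : P ≠ 0) {M : ℝ}
    (hM : ∀ t : ℝ, 0 ≤ t → ‖NormedSpace.exp ((t : ℂ) • (-P))‖ ≤ M) (hw : w ≠ 0)
    (h : w ∈ tauberianSet P 1) : w ∈ interior (powerBoundedSet P) := by
  have hre := hP.re_neg_of_mem_tauberianSet hX hP0 hw (tauberianSet_one_subset h)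
  have hw0 : 0 < ‖w‖ := norm_pos_iff.2 hw
  obtain ⟨C, hC⟩ := mem_tauberianSet_iff.1 h
  simp only [Real.rpow_one] at hC
  have hexp (t : ℝ) (ht : 0 < t) :
      ‖P * NormedSpace.exp ((t : ℂ) • (w • P))‖ ≤ C / ‖w‖ / t := by
    have := norm_mul_exp_le_div hC ht
    rwa [smul_mul_assoc, norm_smul, ← le_div_iff₀' hw0, div_right_comm] at this
  have hconj (t : ℝ) (ht : 0 < t) :
      ‖P * NormedSpace.exp (((t : ℂ) * conj w) • P)‖ ≤ C / ‖w‖ / t := by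
    have h := hP.norm_pow_mul_exp_conj_le hX 1 ((t : ℂ) * w)
    rw [pow_one, map_mul, Complex.conj_ofReal] at h
    exact h.trans (by simpa only [smul_smul] using hexp t ht)
  set D := C / ‖w‖ with hD
  have hsq (t : ℝ) (ht : 0 < t) : ‖(-P) * (-P) * NormedSpace.exp ((t : ℂ) • (-P))‖ ≤
      (D * D * (2 * w.re) ^ 2) / t ^ 2 := by
    -- Chosen so that `s w` plus its conjugate equals `-t`.
    set s := t / (-(2 * w.re)) with hs
    have hs0 : 0 < s := div_pos ht (by linarith)
    have e : (t : ℂ) • (-P) = ((s : ℂ) * w + (s : ℂ) * conj w) • P := by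
      rw [smul_neg, ← neg_smul, ← mul_add, Complex.add_conj, ← Complex.ofReal_mul,
        ← Complex.ofReal_neg]
      congr 2
      rw [hs]
      have := hre.ne
      field_simp
    rw [neg_mul_neg, e]
    refine (norm_sq_mul_exp_add_smul_le _ _ P).trans ((mul_le_mul
      (by simpa only [smul_smul] using hexp s hs0) (hconj s hs0) (norm_nonneg _)
      ((norm_nonneg _).trans (hexp s hs0))).trans_eq ?_)
    rw [hs]
    have := hre.ne
    field_simp
  have hneg (t : ℝ) (ht : 0 < t) := norm_mul_exp_le_of_sq hM hsq ht
  simp only [neg_mul, norm_neg] at hneg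
  obtain ⟨N₁, hN₁⟩ := exists_norm_exp_le hM hneg hexp
  obtain ⟨N, hN⟩ := exists_norm_one_add_pow_le hC hN₁
  have hC' (n : ℕ) : ((n : ℝ) + 1) * ‖P * (1 + w • P) ^ n‖ ≤ D := by
    have := hC n
    rw [smul_mul_assoc, norm_smul, mul_left_comm] at this
    rwa [hD, le_div_iff₀' hw0]
  have hD0 : 0 ≤ D := le_trans (by positivity) (hC' 0)
  -- The radius allowed by `norm_add_smul_pow_le`; the `+ 1` covers `D = 0`.
  set δ := 1 / (4 * D * Real.exp 1 + 1) with hδ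
  have hδ0 : 0 < δ := by positivity
  have hcomm : Commute P (1 + w • P) :=
    (Commute.one_right P).add_right ((Commute.refl P).smul_right w)
  refine mem_interior_iff_mem_nhds.2 (Filter.mem_of_superset (Metric.ball_mem_nhds w hδ0) ?_)
  intro v hv
  rw [Metric.mem_ball, dist_eq_norm] at hv
  refine mem_powerBoundedSet_iff.2 ⟨2 * N, fun n ↦ ?_⟩
  have hη : ‖v - w‖ * (2 * D * Real.exp 1) ≤ 1 / 2 := by
    calc ‖v - w‖ * (2 * D * Real.exp 1) ≤ δ * (2 * D * Real.exp 1) := by gcongr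
      _ ≤ 1 / 2 := by
        rw [hδ, one_div_mul_eq_div, div_le_iff₀ (by positivity)]
        linarith
  have := norm_add_smul_pow_le hcomm hC' hN hη n
  rwa [add_assoc, ← add_smul, add_sub_cancel] at this

/-- If `exp (-t P)` is bounded then the Abel set contains the open left half-plane. -/
theorem mem_abelSet_of_re_neg (hspec : spectrum ℂ P = {0}) {M : ℝ}
    (hM : ∀ t : ℝ, 0 ≤ t → ‖NormedSpace.exp ((t : ℂ) • (-P))‖ ≤ M) (hw : w.re < 0) :
    w ∈ abelSet P 1 := by
  have hw0 : w ≠ 0 := fun h ↦ by simp [h] at hw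
  refine limsup_lt_of_eventually_le (C := ‖w‖ * (M / (-w.re)))
    ((eventually_gt_atTop 0).mono fun s hs ↦ ?_)
  rw [pow_one]
  have hsw : (s : ℂ) * w ≠ 0 := mul_ne_zero (by exact_mod_cast hs.ne') hw0
  have hunit : IsUnit (1 - ((s : ℂ) * w) • P) := by
    have h1 : ((s : ℂ) * w)⁻¹ ∉ spectrum ℂ P := by simpa [hspec, and_comm] using hsw
    rw [spectrum.notMem_iff] at h1
    have h2 := h1.smul (Units.mk0 _ hsw)
    rwa [Units.smul_mk0, smul_sub, Algebra.algebraMap_eq_smul_one, smul_smul,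
      mul_inv_cancel₀ hsw, one_smul] at h2
  set R := Ring.inverse (1 - ((s : ℂ) * w) • P)
  have hR : (1 - ((s : ℂ) * w) • P) * R = 1 := Ring.mul_inverse_cancel _ hunit
  -- Multiplying by `-conj w` turns `1 - s w P` into `D = -conj w + s |w|² P`. Then `exp (-t D)`
  -- decays at rate `-Re w`, uniformly in `s`.
  have hc0 : -conj w ≠ 0 := neg_ne_zero.2 ((map_ne_zero _).2 hw0)
  have hDR : (-conj w • (1 - ((s : ℂ) * w) • P)) * ((-conj w)⁻¹ • R) = 1 := by
    rw [smul_mul_smul_comm, hR, mul_inv_cancel₀ hc0, one_smul]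
  have hbound := norm_le_of_mul_eq_one hDR (M := M) (neg_pos.2 hw) fun t ht ↦ ?_
  · rw [norm_smul, norm_inv, norm_neg, Complex.norm_conj,
      inv_mul_le_iff₀ (norm_pos_iff.2 hw0)] at hbound
    exact hbound
  · have e : (t : ℂ) • -(-conj w • (1 - ((s : ℂ) * w) • P)) =
        ((t : ℂ) * conj w) • (1 : X →L[ℂ] X) + ((t * (s * ‖w‖ ^ 2) : ℝ) : ℂ) • (-P) := by
      have := Complex.conj_mul' w
      push_cast
      rw [← this]
      match_scalars <;> ring
    rw [e, exp_smul_one_add, norm_smul, Complex.norm_exp, mul_comm M]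
    have e2 : ((t : ℂ) * conj w).re = -(-w.re * t) := by simp; ring
    rw [e2]
    gcongr
    exact hM _ (by positivity)

end Sets

section Scaling

variable {X : Type*} [NormedAddCommGroup X] [NormedSpace ℂ X] (Q : X →L[ℂ] X) {ζ : ℂ}

theorem mem_tauberianSet_smul (z : ℂ) (α : ℝ) :
    z ∈ tauberianSet (ζ • Q) α ↔ z * ζ ∈ tauberianSet Q α := by
  simp only [tauberianSet, Set.mem_ofPred_eq, smul_smul]

theorem mem_powerBoundedSet_smul (z : ℂ) :
    z ∈ powerBoundedSet (ζ • Q) ↔ z * ζ ∈ powerBoundedSet Q := by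
  simp only [powerBoundedSet, Set.mem_ofPred_eq, smul_smul]

theorem mem_abelSet_smul (z : ℂ) (k : ℕ) :
    z ∈ abelSet (ζ • Q) k ↔ z * ζ ∈ abelSet Q k := by
  simp only [abelSet, Set.mem_ofPred_eq, smul_smul, mul_assoc]

theorem mem_interior_powerBoundedSet_smul (hζ : ζ ≠ 0) (z : ℂ) :
    z ∈ interior (powerBoundedSet (ζ • Q)) ↔ z * ζ ∈ interior (powerBoundedSet Q) := by
  have h : powerBoundedSet (ζ • Q) = Homeomorph.mulRight₀ ζ hζ ⁻¹' powerBoundedSet Q :=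
    Set.ext fun z ↦ mem_powerBoundedSet_smul Q z
  rw [h, ← Homeomorph.preimage_interior]
  rfl

end Scaling

theorem zero_mem_semigroupSet {X : Type*} [NormedAddCommGroup X] [NormedSpace ℂ X]
    (Q : X →L[ℂ] X) : (0 : ℂ) ∈ semigroupSet Q :=
  limsup_lt_of_eventually_le (C := ‖(1 : X →L[ℂ] X)‖) (Eventually.of_forall fun t ↦ by simp)

end Microspectral

open Microspectral in
theorem theorem6p3 {Ω X : Type*} [NormedAddCommGroup X] [NormedSpace ℂ X] [CompleteSpace X]
    (ev : X →ₗ[ℂ] (Ω → ℂ)) (hX : Microspectral.IsOrderedComplexFunctionSpace ev)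
    (Q : X →L[ℂ] X) (hQ0 : Q ≠ 0) (hQ : Microspectral.IsQuasinilpotent Q)
    (hpos : ∃ z : ℂ, z ≠ 0 ∧ Microspectral.IsPositiveReal ev (z • Q))
    (hG : Microspectral.semigroupSet Q ≠ {0}) :
    (Microspectral.tauberianSet Q 1 = interior (Microspectral.powerBoundedSet Q) ∪ {0} ∧
      interior (Microspectral.powerBoundedSet Q) ∪ {0} ⊆ Microspectral.powerBoundedSet Q) ∧
    Microspectral.tauberianSet Q (1 / 2) ⊆ Microspectral.abelSet Q 1 ∧
    (∀ z : ℂ,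
      (∃ C : ℝ, ∀ j : ℕ, 1 ≤ j →
        ((j : ℝ) + 1) * ‖(1 - (1 + z • Q)) * (1 + z • Q) ^ j‖ ≤ C) →
      ∃ N : ℝ, ∀ j : ℕ, 1 ≤ j → ‖(1 + z • Q) ^ j‖ ≤ N) := by
  obtain ⟨ζ, hζ, hP⟩ := hpos
  have hP0 : ζ • Q ≠ 0 := smul_ne_zero hζ hQ0
  have : Nontrivial (X →L[ℂ] X) := ⟨Q, 0, hQ0⟩
  have hQ' : spectrum ℂ Q = {0} := hQ
  have hspec : spectrum ℂ (ζ • Q) = {0} := by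
    rw [spectrum.smul_eq_smul _ _ (by rw [hQ']; exact Set.singleton_nonempty 0), hQ']
    simp
  obtain ⟨z₀, hz₀, hz₀0⟩ : ∃ z ∈ semigroupSet Q, z ≠ 0 := by
    by_contra! h
    exact hG (Set.eq_singleton_iff_unique_mem.2 ⟨zero_mem_semigroupSet Q, h⟩)
  obtain ⟨M₀, hM₀⟩ := exists_norm_exp_le_of_mem_semigroupSet hz₀
  have hdiv (z : ℂ) : z / ζ * ζ = z := div_mul_cancel₀ z hζ
  obtain ⟨M, hM⟩ := hP.exists_norm_exp_neg_le hX hP0 hspec (div_ne_zero hz₀0 hζ) (M := M₀)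
    (by simpa only [smul_smul, hdiv, mul_assoc] using hM₀)
  have hsub : interior (powerBoundedSet Q) ∪ {0} ⊆ powerBoundedSet Q := by
    refine Set.union_subset interior_subset (Set.singleton_subset_iff.2 ?_)
    exact ⟨‖(1 : X →L[ℂ] X)‖, fun j _ ↦ by simp⟩
  have hT : tauberianSet Q 1 ⊆ interior (powerBoundedSet Q) ∪ {0} := by
    intro z hz
    rcases eq_or_ne z 0 with h0 | h0
    · exact Or.inr h0
    · left
      rw [← hdiv z, ← mem_tauberianSet_smul] at hz
      rw [← hdiv z, ← mem_interior_powerBoundedSet_smul Q hζ]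
      exact hP.mem_interior_of_mem_tauberianSet hX hP0 hM (div_ne_zero h0 hζ) hz
  refine ⟨⟨hT.antisymm (Set.union_subset interior_powerBoundedSet_subset
    (Set.singleton_subset_iff.2 (mem_tauberianSet_iff.2 ⟨0, fun j ↦ by simp⟩))), hsub⟩,
    fun z hz ↦ ?_, fun z ⟨C, hC⟩ ↦ ?_⟩
  · rcases eq_or_ne z 0 with rfl | h0
    · exact limsup_lt_of_eventually_le (C := ‖(1 : X →L[ℂ] X)‖)
        (Eventually.of_forall fun t ↦ by simp)
    · rw [← hdiv z, ← mem_tauberianSet_smul] at hz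
      rw [← hdiv z, ← mem_abelSet_smul]
      exact mem_abelSet_of_re_neg hspec hM
        (hP.re_neg_of_mem_tauberianSet hX hP0 (div_ne_zero h0 hζ) hz)
  · refine hsub (hT (limsup_lt_of_eventually_le (C := C) ?_))
    filter_upwards [eventually_ge_atTop 1] with j hj
    have := hC j hj
    rwa [sub_add_cancel_left, neg_mul, norm_neg, ← Real.rpow_one ((j : ℝ) + 1)] at this
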